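/- **Setting.** For integers $1\le s\le d$ let $\mathbb V(s,d)=\{v\in\mathbb R^d:\|v\|_2=1,\ \|v\|_0\le s\}$, and for a symmetric matrix $M\in\mathbb R^{d\times d}$ put $\lambda_{\max,s}(M)=\sup_{v\in\mathbb V(s,d)}v^{\sf T}Mv$ and $\lambda_{\min,s}(M)=\inf_{v\in\mathbb V(s,d)}v^{\sf T}Mv$. For $C>1$, $\lambda>0$ and sample sizes $n,m\geq 1$ let $\mathbb M(\lambda)$ be the set of pairs $(M_1,M_2)$ of covariance (symmetric positive semidefinite) $d\times d$ matrices with $\lambda_{\min,s}(M_\ell)>0$ and $\lambda_{\max,s}(M_\ell)/\lambda_{\min,s}(M_\ell)\le C$ for $\ell=1,2$, and $$\sqrt{\frac{n+m}{nm}}\ \sup_{v\in\mathbb V(s,d)}\left|\frac{v^{\sf T}(M_1-M_2)v}{v^{\sf T}(M_1/n+M_2/m)v}\right|\ \ge\ \lambda\sqrt{s\log(ed/s)} .$$ A law on $\mathbb R^d$ is called *sub-Gaussian with covariance $\Sigma$* if it is the law of $\Sigma^{1/2}U$ for some random vector $U$ with $\mathbb E U=0$, $\mathbb E UU^{\sf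 T}=I_d$ and $\sup_{\|v\|_2=1}\|v^{\sf T}U\|_{\psi_2}<\infty$, where $\|\cdot\|_{\psi_2}$ is the Orlicz norm for $\psi_2(x)=e^{x^2}-1$. Fix a model $\mathcal M$, that is, a class of sub-Gaussian laws (for each $d$ and each covariance matrix $\Sigma$, a set of sub-Gaussian laws with covariance $\Sigma$) that contains $N_d(0,\Sigma)$ for every positive definite $\Sigma$. (For example: all nondegenerate centered Gaussian laws; all sub-Gaussian laws; or all those with $\psi_2$ norms bounded by some $L\ge\sqrt{8/3}$.) One observes independent i.i.d. samples $X_1,\dots,X_n$ and $Y_1,\dots,Y_m$ from laws in $\mathcal M$ with covariance matrices $\Sigma_1$ and $\Sigma_2$. Let $\mathcal T_\alpha$ be the set of level-$\alpha$ tests of $\mathbf H_0:\Sigma_1=\Sigma_2$, that is, of measurable $\{0,1\}$-valued functions $\Phi$ of the data with $\mathbb P(\Phi=1)\le\alpha$ for all laws in $\mathcal M$ with $\Sigma_1=\Sigma_2$. Define the minimax type-II error $$R_n(\lambda)=\inf_{\Phi\in\mathcal T_\alpha}\ \sup_{(\Sigma_1,\Sigma_2)\in\mathbb M(\lambda)}\mathbb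 P_{(\Sigma_1,\Sigma_2)}(\Phi=0),$$ where the supremum is also over the laws in $\mathcal M$ with covariance matrices $\Sigma_1$ and $\Sigma_2$. **Theorem (minimax lower bound).** Let $\kappa>0$, and consider sequences $m=m_n$, $d=d_n$, $s=s_n$ with $1\le s\le d$, with $n\le\kappa m$ and $m\le\kappa n$ for all large $n$, and with $s\log(ed/s)\log n=o(n)$ as $n\to\infty$. 1. For every $\varepsilon>0$ there is $\lambda_0=\lambda_0(\varepsilon,\kappa)>0$ such that for all $0<\lambda\le\lambda_0$, all $C>1$, all $\alpha\in(0,1)$, every model $\mathcal M$ and all such sequences, $R_n(\lambda)\ge 1-\alpha-\varepsilon$ for all sufficiently large $n$. 2. There is $\lambda_0=\lambda_0(\kappa)>0$ such that for all $0<\lambda\le\lambda_0$, all $C>1$, all $\alpha\in(0,1)$, every model $\mathcal M$ and all such sequences that satisfy in addition $s/d\to0$, one has $R_n(\lambda)\ge 1-\alpha-o(1)$ as $n\to\infty$. -/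

import Mathlib

open MeasureTheory ProbabilityTheory Filter Topology Asymptotics
open scoped ENNReal NNReal Matrix MatrixOrder

noncomputable section

namespace SparseCov

/-- The `s`-sparse vectors on the Euclidean unit sphere of `ℝ^d`. -/
def sparseSphere (s d : ℕ) : Set (EuclideanSpace ℝ (Fin d)) :=
  {v | ‖v‖ = 1 ∧ {i | v i ≠ 0}.ncard ≤ s}

/-- The quadratic form `vᵀ M v`. -/
def quadForm {d : ℕ} (M : Matrix (Fin d) (Fin d) ℝ) (v : EuclideanSpace ℝ (Fin d)) : ℝ :=
  ∑ i, ∑ j, v i * M i j * v j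

/-- The `s`-sparse largest eigenvalue. -/
def sparseEigMax (s : ℕ) {d : ℕ} (M : Matrix (Fin d) (Fin d) ℝ) : ℝ :=
  ⨆ v : sparseSphere s d, quadForm M v

/-- The `s`-sparse smallest eigenvalue. -/
def sparseEigMin (s : ℕ) {d : ℕ} (M : Matrix (Fin d) (Fin d) ℝ) : ℝ :=
  ⨅ v : sparseSphere s d, quadForm M v

/-- The rate `√(s log (e d / s))`. -/
def rate (s d : ℕ) : ℝ := Real.sqrt (s * Real.log (Real.exp 1 * d / s))

/-- The normalized `s`-sparse distance between two covariance matrices, for sample sizes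
`n` and `m`. -/
def separation (n m s : ℕ) {d : ℕ} (M₁ M₂ : Matrix (Fin d) (Fin d) ℝ) : ℝ :=
  Real.sqrt (((n : ℝ) + m) / ((n : ℝ) * m)) *
    ⨆ v : sparseSphere s d,
      |quadForm (M₁ - M₂) v / quadForm ((n : ℝ)⁻¹ • M₁ + (m : ℝ)⁻¹ • M₂) v|

/-- The alternative class `𝕄(lam)` of pairs of covariance matrices; the condition
`sparseEigMax / sparseEigMin ≤ C` includes that the denominator is positive. -/
def alternatives (C lam : ℝ) (n m s d : ℕ) :
    Set (Matrix (Fin d) (Fin d) ℝ × Matrix (Fin d) (Fin d) ℝ) :=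
  {M | (M.1.PosSemidef ∧ 0 < sparseEigMin s M.1 ∧ sparseEigMax s M.1 / sparseEigMin s M.1 ≤ C) ∧
    (M.2.PosSemidef ∧ 0 < sparseEigMin s M.2 ∧ sparseEigMax s M.2 / sparseEigMin s M.2 ≤ C) ∧
    lam * rate s d ≤ separation n m s M.1 M.2}

/-- The Orlicz norm of `X` for `ψ₂(x) = exp (x ^ 2) - 1`, with value `∞` if there is no
admissible constant. -/
def psi2Norm {Ω : Type*} [MeasurableSpace Ω] (μ : Measure Ω) (X : Ω → ℝ) : ℝ≥0∞ :=
  ⨅ (K : ℝ≥0) (_ : 0 < K)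
    (_ : ∫⁻ ω, ENNReal.ofReal (Real.exp ((X ω / K) ^ 2) - 1) ∂μ ≤ 1), (K : ℝ≥0∞)

/-- `P` is the law of `S^{1/2} U`, where `U` has mean zero, identity covariance and
uniformly sub-Gaussian one-dimensional projections. (Finiteness of the `ψ₂` norms makes the
integrals below integrals of integrable functions.) -/
def IsSubGaussianLaw {d : ℕ} (S : Matrix (Fin d) (Fin d) ℝ)
    (P : Measure (EuclideanSpace ℝ (Fin d))) : Prop :=
  S.PosSemidef ∧ ∃ U : Measure (EuclideanSpace ℝ (Fin d)), IsProbabilityMeasure U ∧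
    (∀ i, ∫ u, u i ∂U = 0) ∧
    (∀ i j, ∫ u, u i * u j ∂U = (1 : Matrix (Fin d) (Fin d) ℝ) i j) ∧
    (⨆ v ∈ Metric.sphere (0 : EuclideanSpace ℝ (Fin d)) 1,
      psi2Norm U (fun u => inner ℝ v u)) < ∞ ∧
    P = U.map (fun u => Matrix.toEuclideanCLM (𝕜 := ℝ) (CFC.sqrt S) u)

/-- A statistical model assigns to every dimension `d` and every matrix `S` the set of laws
on `ℝ^d` with covariance matrix `S` that one observation may have. -/
abbrev Model : Type :=
  ∀ d : ℕ, Matrix (Fin d) (Fin d) ℝ → Set (Measure (EuclideanSpace ℝ (Fin d)))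

/-- Every law in the model is sub-Gaussian, and the nondegenerate centered Gaussian laws are
in the model. Examples: the Gaussian model, the model of all sub-Gaussian laws, and the model
of all sub-Gaussian laws with `ψ₂` norms at most `L`, for `L ≥ √(8/3)`. -/
def Model.IsAdmissible (𝓜 : Model) : Prop :=
  (∀ d S P, P ∈ 𝓜 d S → IsSubGaussianLaw S P) ∧
  (∀ d S, S.PosDef → multivariateGaussian 0 S ∈ 𝓜 d S)

/-- The data `(X₁, …, Xₙ), (Y₁, …, Yₘ)` in `ℝ^d`. -/
abbrev Sample (n m d : ℕ) : Type :=
  (Fin n → EuclideanSpace ℝ (Fin d)) × (Fin m → EuclideanSpace ℝ (Fin d))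

/-- The joint law of two independent i.i.d. samples, of size `n` from `P` and of size `m`
from `Q`. -/
def sampleLaw (n m : ℕ) {d : ℕ} (P Q : Measure (EuclideanSpace ℝ (Fin d))) :
    Measure (Sample n m d) :=
  (Measure.pi fun _ => P).prod (Measure.pi fun _ => Q)

/-- The level-`α` tests of equality of the two covariance matrices: `{0,1}`-valued measurable
functions of the data that take the value `1` with probability at most `α` whenever the two
populations have the same covariance matrix. -/
def levelTests (𝓜 : Model) (α : ℝ) (n m d : ℕ) : Set (Sample n m d → Fin 2) :=
  {Φ | Measurable Φ ∧ ∀ S, ∀ P ∈ 𝓜 d S, ∀ Q ∈ 𝓜 d S,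
    sampleLaw n m P Q {x | Φ x = 1} ≤ ENNReal.ofReal α}

/-- The smallest worst-case type-II error over `𝕄(lam)` of a level-`α` test. -/
def minimaxTypeII (𝓜 : Model) (α C lam : ℝ) (n m s d : ℕ) : ℝ≥0∞ :=
  ⨅ Φ ∈ levelTests 𝓜 α n m d, ⨆ S ∈ alternatives C lam n m s d,
    ⨆ P ∈ 𝓜 d S.1, ⨆ Q ∈ 𝓜 d S.2, sampleLaw n m P Q {x | Φ x = 0}

/-- The asymptotic regime: `1 ≤ s ≤ d`, sample sizes comparable with constant `κ`, and
`s log (e d / s) log n = o(n)`. -/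
structure Regime (κ : ℝ) (m d s : ℕ → ℕ) : Prop where
  one_le : ∀ n, 1 ≤ s n
  le_dim : ∀ n, s n ≤ d n
  comparable : ∀ᶠ n : ℕ in atTop, (n : ℝ) ≤ κ * m n ∧ (m n : ℝ) ≤ κ * n
  scaling : (fun n : ℕ => s n * Real.log (Real.exp 1 * d n / s n) * Real.log n)
    =o[atTop] fun n : ℕ => (n : ℝ)

end SparseCov

end

namespace SparseCov

/-! The bound is Le Cam's method with a random sparse spike. Under the null both populations are
`N(0, I)`. The alternatives give the second one the covariance `I + τ² v vᵀ`, where `v` is uniform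
over the signed vectors with one entry `±s^{-1/2}` in each of `s` disjoint blocks of `b = ⌊d/s⌋`
coordinates. Write `q = 1/n + 1/m` and `L = log(ed/s)`. Testing the distance at `v` itself shows
that `τ² = 2 lam √(q s L)` is separated enough (`one_spikedCov_mem_alternatives`), and `s L = o(n)`
makes `τ²` small, so the pair is well conditioned.

If the mixture likelihood ratio has second moment at most `1 + δ²`, every level-`α` test has
worst-case type-II error at least `1 - α - δ` (`measure_le_withDensity_add`,
`le_minimaxTypeII_of_spikes`). The cross moment of two spikes is at most `exp(m τ⁴⟨v,v'⟩²) = exp(a L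
S² / s)`, where `a = 4 lam² q m` and `S` is a sum of `s` independent overlaps, each nonzero with
probability `1/b`. Writing the exponential of a square as a Gaussian average makes the mean factor
over blocks, and `1/b ≤ 6 e^{-L}` brings it down to `1 + 224 a / L` (`sum_exp_overlap_sq_le`). For
fixed `ε` one takes `a` small; if `s/d → 0`, then `L → ∞` and `a ≤ 1/64` suffices. -/

/-! ### Product densities and the second moment method. -/

theorem lintegral_pi_prod {ι Ω : Type*} [Fintype ι] [MeasurableSpace Ω]
    (μ : ι → Measure Ω) [∀ i, IsProbabilityMeasure (μ i)] {f : ι → Ω → ℝ≥0∞}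
    (hf : ∀ i, Measurable (f i)) :
    ∫⁻ x, ∏ i, f i (x i) ∂(Measure.pi μ) = ∏ i, ∫⁻ y, f i y ∂(μ i) := by
  have hind : iIndepFun (fun i (x : ι → Ω) => f i (x i)) (Measure.pi μ) :=
    iIndepFun_pi (X := f) fun i => (hf i).aemeasurable
  have h := lintegral_prod_eq_prod_lintegral_of_indepFun Finset.univ _ hind
    (fun i => (hf i).comp (measurable_pi_apply i))
  rw [h]
  refine Finset.prod_congr rfl fun i _ => ?_
  exact (measurePreserving_eval μ i).lintegral_comp (hf i)

theorem pi_withDensity {ι Ω : Type*} [Fintype ι] [MeasurableSpace Ω]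
    (μ : ι → Measure Ω) [∀ i, IsProbabilityMeasure (μ i)] {f : ι → Ω → ℝ≥0∞}
    (hf : ∀ i, Measurable (f i)) [∀ i, SigmaFinite ((μ i).withDensity (f i))] :
    Measure.pi (fun i => (μ i).withDensity (f i)) =
      (Measure.pi μ).withDensity fun x => ∏ i, f i (x i) := by
  refine Measure.pi_eq fun A hA => ?_
  rw [withDensity_apply _ (MeasurableSet.univ_pi hA),
    ← lintegral_indicator (MeasurableSet.univ_pi hA)]
  have h : (Set.univ.pi A).indicator (fun x => ∏ i, f i (x i)) =
      fun x => ∏ i, (A i).indicator (f i) (x i) := by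
    funext x
    by_cases hx : x ∈ Set.univ.pi A
    · rw [Set.indicator_of_mem hx]
      exact Finset.prod_congr rfl fun i _ => (Set.indicator_of_mem (hx i trivial) _).symm
    · rw [Set.indicator_of_notMem hx]
      simp only [Set.mem_pi, Set.mem_univ, forall_const, not_forall] at hx
      obtain ⟨i, hi⟩ := hx
      exact (Finset.prod_eq_zero (Finset.mem_univ i) (Set.indicator_of_notMem hi _)).symm
  rw [h, lintegral_pi_prod μ fun i => (hf i).indicator (hA i)]
  refine Finset.prod_congr rfl fun i _ => ?_
  rw [lintegral_indicator (hA i), withDensity_apply _ (hA i)]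

/-- A likelihood ratio whose second moment is close to one is close to one in mean. -/
theorem measure_le_withDensity_add {Ω : Type*} [MeasurableSpace Ω] (P : Measure Ω)
    [IsProbabilityMeasure P] {F : Ω → ℝ≥0∞} (hF : Measurable F) (hF1 : ∫⁻ x, F x ∂P = 1)
    {δ : ℝ} (hδ : 0 < δ) (hF2 : ∫⁻ x, F x * F x ∂P ≤ ENNReal.ofReal (1 + δ ^ 2))
    {A : Set Ω} (hA : MeasurableSet A) :
    P A ≤ P.withDensity F A + ENNReal.ofReal δ := by
  -- This is `1_A (1 - F) ≤ (F - 1)² / (2δ) + δ / 2`, by AM-GM, with the square expanded and the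
  -- negative terms moved across because subtraction truncates in `ℝ≥0∞`. Integrated, the right side
  -- is at most `δ`.
  have key : ∀ x, A.indicator 1 x + ENNReal.ofReal δ⁻¹ * F x ≤
      A.indicator F x + ENNReal.ofReal (2 * δ)⁻¹ * (F x * F x) +
        ENNReal.ofReal ((2 * δ)⁻¹ + δ / 2) := by
    intro x
    rcases eq_or_ne (F x) ∞ with hx | hx
    · have : ENNReal.ofReal (2 * δ)⁻¹ * (F x * F x) = ∞ := by
        rw [hx, ENNReal.top_mul_top, ENNReal.mul_top]
        simpa using hδ
      rw [this]
      simp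
    · obtain ⟨r, hr⟩ : ∃ r : ℝ≥0, F x = r := ⟨(F x).toNNReal, (ENNReal.coe_toNNReal hx).symm⟩
      have hr' : F x = ENNReal.ofReal r := by rw [hr, ENNReal.ofReal_coe_nnreal]
      have h2 : (r : ℝ) ^ 2 * (2 * δ)⁻¹ + ((2 * δ)⁻¹ + δ / 2) - δ⁻¹ * r - (1 - r)
          = ((r : ℝ) - 1 + δ) ^ 2 * (2 * δ)⁻¹ := by
        field_simp; ring
      have h3 : (r : ℝ) ^ 2 * (2 * δ)⁻¹ + ((2 * δ)⁻¹ + δ / 2) - δ⁻¹ * r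
          = ((r : ℝ) - 1) ^ 2 * (2 * δ)⁻¹ + δ / 2 := by
        field_simp; ring
      have h4 : 0 ≤ ((r : ℝ) - 1 + δ) ^ 2 * (2 * δ)⁻¹ := by positivity
      have h5 : 0 ≤ ((r : ℝ) - 1) ^ 2 * (2 * δ)⁻¹ + δ / 2 := by positivity
      have hr0 : (0 : ℝ) ≤ r := r.2
      by_cases hxA : x ∈ A
      · rw [Set.indicator_of_mem hxA, Set.indicator_of_mem hxA, hr', Pi.one_apply,
          ← ENNReal.ofReal_one, ← ENNReal.ofReal_mul (by positivity),
          ← ENNReal.ofReal_mul hr0, ← ENNReal.ofReal_mul (by positivity),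
          ← ENNReal.ofReal_add (by positivity) (by positivity),
          ← ENNReal.ofReal_add (by positivity) (by positivity),
          ← ENNReal.ofReal_add (by positivity) (by positivity)]
        refine ENNReal.ofReal_le_ofReal ?_
        nlinarith
      · rw [Set.indicator_of_notMem hxA, Set.indicator_of_notMem hxA, hr',
          ← ENNReal.ofReal_mul (by positivity),
          ← ENNReal.ofReal_mul hr0, ← ENNReal.ofReal_mul (by positivity), zero_add, zero_add,
          ← ENNReal.ofReal_add (by positivity) (by positivity)]
        refine ENNReal.ofReal_le_ofReal ?_
        nlinarith
  have h := lintegral_mono (μ := P) key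
  rw [lintegral_add_left (measurable_one.indicator hA), lintegral_const_mul _ hF, hF1, mul_one,
    lintegral_add_right _ measurable_const,
    lintegral_add_left (hF.indicator hA),
    lintegral_const_mul (f := fun x => F x * F x) _ (hF.mul hF),
    lintegral_indicator_one hA, lintegral_indicator hA, ← withDensity_apply _ hA,
    lintegral_const, measure_univ, mul_one] at h
  have h6 : P A + ENNReal.ofReal δ⁻¹ ≤
      P.withDensity F A + ENNReal.ofReal δ + ENNReal.ofReal δ⁻¹ := by
    refine h.trans ?_
    rw [add_assoc, add_assoc]
    refine add_le_add le_rfl ((add_le_add (mul_le_mul' le_rfl hF2) le_rfl).trans ?_)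
    rw [← ENNReal.ofReal_mul (by positivity), ← ENNReal.ofReal_add (by positivity) (by positivity),
      ← ENNReal.ofReal_add (by positivity) (by positivity)]
    refine ENNReal.ofReal_le_ofReal (le_of_eq ?_)
    field_simp; ring
  exact (ENNReal.add_le_add_iff_right ENNReal.ofReal_ne_top).1 h6

/-! ### Gaussian integrals and shifted Gaussian densities. -/

theorem lintegral_exp_mul_gaussianReal (t : ℝ) :
    ∫⁻ g, ENNReal.ofReal (Real.exp (t * g)) ∂(gaussianReal 0 1) =
      ENNReal.ofReal (Real.exp (t ^ 2 / 2)) := by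
  rw [← ofReal_integral_eq_lintegral_ofReal (integrable_exp_mul_gaussianReal t)
    (ae_of_all _ fun _ => (Real.exp_pos _).le)]
  have h := congrFun (mgf_fun_id_gaussianReal (μ := 0) (v := 1)) t
  rw [mgf] at h
  rw [h]
  simp

theorem lintegral_exp_sq_gaussianReal {p : ℝ} (hp : p < 1 / 2) :
    ∫⁻ g, ENNReal.ofReal (Real.exp (p * g ^ 2)) ∂(gaussianReal 0 1) =
      ENNReal.ofReal (Real.sqrt (1 - 2 * p))⁻¹ := by
  rw [gaussianReal_of_var_ne_zero _ one_ne_zero,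
    lintegral_withDensity_eq_lintegral_mul _ (measurable_gaussianPDF _ _) (by fun_prop)]
  have h : ∀ g : ℝ, (gaussianPDF 0 1 * fun g => ENNReal.ofReal (Real.exp (p * g ^ 2))) g =
      ENNReal.ofReal ((Real.sqrt (2 * Real.pi))⁻¹ * Real.exp (-(1 / 2 - p) * g ^ 2)) := by
    intro g
    simp only [Pi.mul_apply, gaussianPDF, gaussianPDFReal]
    rw [← ENNReal.ofReal_mul (by positivity), mul_assoc, ← Real.exp_add]
    congr 3
    · simp
    · simp; ring
  simp_rw [h]
  rw [← ofReal_integral_eq_lintegral_ofReal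
    ((integrable_exp_neg_mul_sq (by linarith)).const_mul _)
    (ae_of_all _ fun _ => by positivity), integral_const_mul, integral_gaussian]
  congr 1
  rw [← Real.sqrt_inv, ← Real.sqrt_mul (by positivity), ← Real.sqrt_inv]
  congr 1
  have : 1 - 2 * p ≠ 0 := by linarith
  have : (1 / 2 - p) ≠ 0 := by linarith
  field_simp

theorem inv_sqrt_one_sub_le {x : ℝ} (h0 : 0 ≤ x) (h1 : x ≤ 1 / 2) :
    (Real.sqrt (1 - x))⁻¹ ≤ 1 + x := by
  rw [inv_le_comm₀ (Real.sqrt_pos.2 (by linarith)) (by linarith)]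
  refine Real.le_sqrt_of_sq_le ?_
  rw [inv_pow, inv_le_iff_one_le_mul₀ (by positivity)]
  nlinarith [mul_nonneg h0 (sq_nonneg x), mul_nonneg h0 h0]

/-- The density of the shifted standard Gaussian measure `N(w, I)` with respect to `N(0, I)`. -/
noncomputable def shiftDensity {d : ℕ} (w y : EuclideanSpace ℝ (Fin d)) : ℝ≥0∞ :=
  ENNReal.ofReal (Real.exp (inner ℝ w y - ‖w‖ ^ 2 / 2))

theorem measurable_shiftDensity_comp {d : ℕ} {α : Type*} [MeasurableSpace α]
    {w y : α → EuclideanSpace ℝ (Fin d)} (hw : Measurable w) (hy : Measurable y) :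
    Measurable fun a => shiftDensity (w a) (y a) := by
  unfold shiftDensity
  fun_prop

theorem measurable_shiftDensity {d : ℕ} (w : EuclideanSpace ℝ (Fin d)) :
    Measurable (shiftDensity w) := by
  unfold shiftDensity
  fun_prop

theorem gaussianReal_withDensity_exp (c : ℝ) :
    (gaussianReal 0 1).withDensity (fun y => ENNReal.ofReal (Real.exp (c * y - c ^ 2 / 2))) =
      gaussianReal c 1 := by
  rw [gaussianReal_of_var_ne_zero _ one_ne_zero, gaussianReal_of_var_ne_zero _ one_ne_zero,
    ← withDensity_mul _ (measurable_gaussianPDF _ _) (by fun_prop)]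
  congr 1
  funext y
  simp only [Pi.mul_apply, gaussianPDF, gaussianPDFReal]
  rw [← ENNReal.ofReal_mul (by positivity), mul_assoc, ← Real.exp_add]
  congr 3
  simp
  ring

theorem stdGaussian_withDensity_shiftDensity {d : ℕ} (w : EuclideanSpace ℝ (Fin d)) :
    (stdGaussian (EuclideanSpace ℝ (Fin d))).withDensity (shiftDensity w) =
      (stdGaussian (EuclideanSpace ℝ (Fin d))).map (fun y => y + w) := by
  have hp : Measure.pi (fun i => gaussianReal (w i) 1) =
      (Measure.pi fun _ : Fin d => gaussianReal 0 1).withDensity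
        fun y => ∏ i, ENNReal.ofReal (Real.exp (w i * y i - w i ^ 2 / 2)) := by
    have : ∀ i : Fin d, SigmaFinite ((gaussianReal 0 1).withDensity
        (fun y => ENNReal.ofReal (Real.exp (w i * y - w i ^ 2 / 2)))) := fun i => by
      rw [gaussianReal_withDensity_exp]; infer_instance
    rw [← pi_withDensity (fun _ => gaussianReal 0 1)
      (f := fun i y => ENNReal.ofReal (Real.exp (w i * y - w i ^ 2 / 2))) (fun i => by fun_prop)]
    simp only [gaussianReal_withDensity_exp]
  have hs : Measure.pi (fun i => gaussianReal (w i) 1) =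
      (Measure.pi fun _ : Fin d => gaussianReal 0 1).map (fun y i => y i + w i) := by
    rw [Measure.pi_map_pi (f := fun i (y : ℝ) => y + w i) (fun i => by fun_prop)]
    simp [gaussianReal_map_add_const]
  ext A hA
  rw [← map_pi_eq_stdGaussian, Measure.map_map (by fun_prop) (by fun_prop),
    Measure.map_apply (by fun_prop) hA, withDensity_apply _ hA,
    setLIntegral_map hA (measurable_shiftDensity w) (by fun_prop)]
  have h1 : (fun y => y + w) ∘ WithLp.toLp 2 =
      (WithLp.toLp 2 : (Fin d → ℝ) → EuclideanSpace ℝ (Fin d)) ∘ fun y i => y i + w i := by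
    funext y
    ext i
    simp
  have hm : MeasurableSet ((WithLp.toLp 2 : (Fin d → ℝ) → EuclideanSpace ℝ (Fin d)) ⁻¹' A) :=
    (by fun_prop : Measurable (WithLp.toLp 2 : (Fin d → ℝ) → EuclideanSpace ℝ (Fin d))) hA
  rw [h1, Set.preimage_comp, ← Measure.map_apply (by fun_prop) hm, ← hs, hp,
    withDensity_apply _ hm]
  refine lintegral_congr fun y => ?_
  rw [← ENNReal.ofReal_prod_of_nonneg (fun _ _ => (Real.exp_pos _).le), ← Real.exp_sum]
  unfold shiftDensity
  congr 2
  rw [EuclideanSpace.real_norm_sq_eq, PiLp.inner_apply, Finset.sum_div, ← Finset.sum_sub_distrib]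
  simp [mul_comm]

theorem lintegral_shiftDensity {d : ℕ} (w : EuclideanSpace ℝ (Fin d)) :
    ∫⁻ y, shiftDensity w y ∂(stdGaussian (EuclideanSpace ℝ (Fin d))) = 1 := by
  rw [← setLIntegral_univ, ← withDensity_apply _ MeasurableSet.univ,
    stdGaussian_withDensity_shiftDensity, Measure.map_apply (by fun_prop) MeasurableSet.univ]
  simp

/-- The product of the densities of the shifts by `w` and `w'` is `exp ⟨w, w'⟩` times the density of
the shift by `w + w'`. -/
theorem lintegral_shiftDensity_mul {d : ℕ} (w w' : EuclideanSpace ℝ (Fin d)) :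
    ∫⁻ y, shiftDensity w y * shiftDensity w' y ∂(stdGaussian (EuclideanSpace ℝ (Fin d))) =
      ENNReal.ofReal (Real.exp (inner ℝ w w')) := by
  have h : ∀ y, shiftDensity w y * shiftDensity w' y =
      ENNReal.ofReal (Real.exp (inner ℝ w w')) * shiftDensity (w + w') y := by
    intro y
    unfold shiftDensity
    rw [← ENNReal.ofReal_mul (Real.exp_pos _).le, ← ENNReal.ofReal_mul (Real.exp_pos _).le,
      ← Real.exp_add, ← Real.exp_add, norm_add_sq_real, inner_add_left]
    congr 2
    ring
  simp_rw [h]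
  rw [lintegral_const_mul _ (measurable_shiftDensity _), lintegral_shiftDensity, mul_one]

/-! ### Likelihood ratios of spiked Gaussian laws. -/

/-- The density of `N(0, I + τ² v vᵀ)` with respect to `N(0, I)`, as a Gaussian mixture of
shifts along `v`. -/
noncomputable def spikeDensity {d : ℕ} (τ : ℝ) (v y : EuclideanSpace ℝ (Fin d)) : ℝ≥0∞ :=
  ∫⁻ g, shiftDensity ((τ * g) • v) y ∂(gaussianReal 0 1)

theorem measurable_shiftDensity_smul {d : ℕ} (τ : ℝ) (v : EuclideanSpace ℝ (Fin d)) :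
    Measurable fun p : EuclideanSpace ℝ (Fin d) × ℝ => shiftDensity ((τ * p.2) • v) p.1 := by
  unfold shiftDensity
  fun_prop

theorem measurable_spikeDensity {d : ℕ} (τ : ℝ) (v : EuclideanSpace ℝ (Fin d)) :
    Measurable (spikeDensity τ v) :=
  (measurable_shiftDensity_smul τ v).lintegral_prod_right'

/-- The covariance matrix `I + τ² v vᵀ`. -/
noncomputable def spikedCov {d : ℕ} (τ : ℝ) (v : EuclideanSpace ℝ (Fin d)) : Matrix (Fin d) (Fin d) ℝ :=
  1 + τ ^ 2 • Matrix.vecMulVec v v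

theorem posDef_spikedCov {d : ℕ} (τ : ℝ) (v : EuclideanSpace ℝ (Fin d)) :
    (spikedCov τ v).PosDef := by
  refine Matrix.PosDef.one.add_posSemidef (Matrix.PosSemidef.smul ?_ (sq_nonneg τ))
  simpa using Matrix.posSemidef_vecMulVec_self_star (v : Fin d → ℝ)

theorem dotProduct_spikedCov {d : ℕ} (τ : ℝ) (v x : EuclideanSpace ℝ (Fin d)) :
    (x : Fin d → ℝ) ⬝ᵥ spikedCov τ v *ᵥ (x : Fin d → ℝ) =
      ‖x‖ ^ 2 + τ ^ 2 * (inner ℝ v x) ^ 2 := by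
  have h1 : (x : Fin d → ℝ) ⬝ᵥ (x : Fin d → ℝ) = ‖x‖ ^ 2 := by
    rw [EuclideanSpace.real_norm_sq_eq]
    simp [dotProduct, sq]
  have h2 : (v : Fin d → ℝ) ⬝ᵥ (x : Fin d → ℝ) = inner ℝ v x := by
    simp [PiLp.inner_apply, dotProduct, mul_comm]
  rw [spikedCov, Matrix.add_mulVec, Matrix.one_mulVec, dotProduct_add, Matrix.smul_mulVec,
    dotProduct_smul, Matrix.vecMulVec_mulVec, h1, h2, dotProduct_smul, dotProduct_comm, h2]
  simp [sq]

/-- A spiked Gaussian vector is `Z + τ g v` with `Z` and `g` independent standard Gaussians;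
conditioning on `g` reduces it to a shift. -/
theorem multivariateGaussian_spikedCov_eq_conv {d : ℕ} (τ : ℝ)
    (v : EuclideanSpace ℝ (Fin d)) :
    multivariateGaussian 0 (spikedCov τ v) =
      (stdGaussian (EuclideanSpace ℝ (Fin d))).conv
        ((gaussianReal 0 1).map fun g => (τ * g) • v) := by
  have : IsProbabilityMeasure ((gaussianReal 0 1).map fun g => (τ * g) • v) :=
    Measure.isProbabilityMeasure_map (by fun_prop)
  apply Measure.ext_of_charFun
  funext t
  rw [charFun_multivariateGaussian (posDef_spikedCov τ v).posSemidef, charFun_conv,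
    charFun_stdGaussian, dotProduct_spikedCov, charFun_apply,
    integral_map (by fun_prop) (by fun_prop)]
  have h : ∫ g, Complex.exp (((inner ℝ ((τ * g) • v) t : ℝ) : ℂ) * Complex.I)
      ∂(gaussianReal 0 1) = charFun (gaussianReal 0 1) (τ * inner ℝ v t) := by
    rw [charFun_apply_real]
    refine integral_congr_ae (ae_of_all _ fun g => ?_)
    simp only [real_inner_smul_left]
    push_cast
    ring_nf
  rw [h, charFun_gaussianReal, ← Complex.exp_add]
  congr 1
  simp
  ring

theorem multivariateGaussian_spikedCov {d : ℕ} (τ : ℝ) (v : EuclideanSpace ℝ (Fin d)) :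
    multivariateGaussian 0 (spikedCov τ v) =
      (stdGaussian (EuclideanSpace ℝ (Fin d))).withDensity (spikeDensity τ v) := by
  have : IsProbabilityMeasure ((gaussianReal 0 1).map fun g => (τ * g) • v) :=
    Measure.isProbabilityMeasure_map (by fun_prop)
  rw [multivariateGaussian_spikedCov_eq_conv, Measure.conv_comm]
  ext A hA
  rw [withDensity_apply _ hA, ← lintegral_indicator_one hA,
    Measure.lintegral_conv (measurable_one.indicator hA),
    lintegral_map (Measurable.lintegral_prod_right'
      (f := fun p : EuclideanSpace ℝ (Fin d) × EuclideanSpace ℝ (Fin d) =>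
        A.indicator (1 : EuclideanSpace ℝ (Fin d) → ℝ≥0∞) (p.1 + p.2))
      ((measurable_one.indicator hA).comp (by fun_prop))) (by fun_prop)]
  unfold spikeDensity
  conv_rhs => rw [lintegral_lintegral_swap (measurable_shiftDensity_smul τ v).aemeasurable]
  refine lintegral_congr fun g => ?_
  rw [← withDensity_apply _ hA, stdGaussian_withDensity_shiftDensity,
    ← lintegral_indicator_one hA, lintegral_map (measurable_one.indicator hA) (by fun_prop)]
  simp_rw [add_comm]

theorem lintegral_spikeDensity {d : ℕ} (τ : ℝ) (v : EuclideanSpace ℝ (Fin d)) :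
    ∫⁻ y, spikeDensity τ v y ∂(stdGaussian (EuclideanSpace ℝ (Fin d))) = 1 := by
  rw [← setLIntegral_univ, ← withDensity_apply _ MeasurableSet.univ,
    ← multivariateGaussian_spikedCov, measure_univ]

theorem lintegral_shiftDensity_smul_mul {d : ℕ} (τ g : ℝ) (v v' : EuclideanSpace ℝ (Fin d)) :
    ∫⁻ y, ∫⁻ g', shiftDensity ((τ * g) • v) y * shiftDensity ((τ * g') • v') y
      ∂(gaussianReal 0 1) ∂(stdGaussian (EuclideanSpace ℝ (Fin d))) =
      ENNReal.ofReal (Real.exp ((τ ^ 2 * inner ℝ v v') ^ 2 / 2 * g ^ 2)) := by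
  rw [lintegral_lintegral_swap]
  · simp_rw [lintegral_shiftDensity_mul, real_inner_smul_left, real_inner_smul_right]
    have h : ∀ g' : ℝ, τ * g * (τ * g' * inner ℝ v v') =
        (τ ^ 2 * inner ℝ v v' * g) * g' := by
      intro g'; ring
    simp_rw [h]
    rw [lintegral_exp_mul_gaussianReal]
    congr 2
    ring
  · exact ((measurable_shiftDensity_comp (measurable_const (a := (τ * g) • v))
      measurable_fst).mul (measurable_shiftDensity_comp
        (w := fun p : EuclideanSpace ℝ (Fin d) × ℝ => (τ * p.2) • v') (by fun_prop)
        measurable_fst)).aemeasurable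

theorem spikeDensity_mul {d : ℕ} (τ : ℝ) (v v' y : EuclideanSpace ℝ (Fin d)) :
    spikeDensity τ v y * spikeDensity τ v' y =
      ∫⁻ g, ∫⁻ g', shiftDensity ((τ * g) • v) y * shiftDensity ((τ * g') • v') y
        ∂(gaussianReal 0 1) ∂(gaussianReal 0 1) := by
  have hm : ∀ u : EuclideanSpace ℝ (Fin d), Measurable fun g => shiftDensity ((τ * g) • u) y :=
    fun u => measurable_shiftDensity_comp (by fun_prop) measurable_const
  unfold spikeDensity
  rw [← lintegral_mul_const _ (hm v)]
  refine lintegral_congr fun g => ?_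
  rw [lintegral_const_mul _ (hm v')]

/-- The exact value is `(1 - r²)^{-1/2}` with `r = τ²⟨v, v'⟩`. The exponential bound is the form
that multiplies well over observations. -/
theorem lintegral_spikeDensity_mul_le {d : ℕ} (τ : ℝ) (v v' : EuclideanSpace ℝ (Fin d))
    (h : (τ ^ 2 * inner ℝ v v') ^ 2 ≤ 1 / 2) :
    ∫⁻ y, spikeDensity τ v y * spikeDensity τ v' y ∂(stdGaussian (EuclideanSpace ℝ (Fin d))) ≤
      ENNReal.ofReal (Real.exp ((τ ^ 2 * inner ℝ v v') ^ 2)) := by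
  have hm : Measurable (Function.uncurry fun (y : EuclideanSpace ℝ (Fin d)) (g : ℝ) =>
      ∫⁻ g', shiftDensity ((τ * g) • v) y * shiftDensity ((τ * g') • v') y
        ∂(gaussianReal 0 1)) := by
    refine Measurable.lintegral_prod_right' (f := fun p : (EuclideanSpace ℝ (Fin d) × ℝ) × ℝ =>
      shiftDensity ((τ * p.1.2) • v) p.1.1 * shiftDensity ((τ * p.2) • v') p.1.1) ?_
    exact (measurable_shiftDensity_comp (by fun_prop) (by fun_prop)).mul
      (measurable_shiftDensity_comp (by fun_prop) (by fun_prop))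
  rw [lintegral_congr (spikeDensity_mul τ v v'), lintegral_lintegral_swap hm.aemeasurable,
    lintegral_congr fun g => lintegral_shiftDensity_smul_mul τ g v v']
  generalize τ ^ 2 * inner ℝ v v' = r at h
  rw [lintegral_exp_sq_gaussianReal (by linarith)]
  refine ENNReal.ofReal_le_ofReal ?_
  have := inv_sqrt_one_sub_le (sq_nonneg r) h
  rw [show 2 * (r ^ 2 / 2) = r ^ 2 by ring]
  linarith [Real.add_one_le_exp (r ^ 2)]

/-! ### The second moment of the block prior. -/

/-- The sign `±1` encoded by a Boolean. -/
noncomputable def boolSign (c : Bool) : ℝ := if c then 1 else -1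

/-- The inner product of two signed coordinate vectors. -/
noncomputable def overlap {b : ℕ} (p q : Fin b × Bool) : ℝ :=
  if p.1 = q.1 then boolSign p.2 * boolSign q.2 else 0

/-- Up to the count `(2b)²`, this is the moment generating function of a variable equal to `0` with
probability `1 - 1/b` and to `±1` with probability `1/(2b)` each. -/
theorem sum_exp_mul_overlap {b : ℕ} (hb : 1 ≤ b) (x : ℝ) :
    ∑ p : Fin b × Bool, ∑ q : Fin b × Bool, Real.exp (x * overlap p q) =
      (b * 2) ^ 2 * (1 + (Real.cosh x - 1) / b) := by
  have h : ∀ p : Fin b × Bool, ∑ q : Fin b × Bool, Real.exp (x * overlap p q) =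
      2 * b + 2 * (Real.cosh x - 1) := by
    rintro ⟨i, c⟩
    have h1 : ∀ j : Fin b, ∑ c' : Bool, Real.exp (x * overlap (i, c) (j, c')) =
        2 + if i = j then 2 * (Real.cosh x - 1) else 0 := by
      intro j
      by_cases hij : i = j
      · rcases c <;> simp [overlap, boolSign, hij, Real.cosh_eq] <;> ring
      · simp [overlap, hij]
    rw [Fintype.sum_prod_type]
    simp_rw [h1]
    simp [Finset.sum_add_distrib]
    ring
  simp_rw [h]
  have hb' : (b : ℝ) ≠ 0 := by positivity
  simp [Fintype.card_prod]
  field_simp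

theorem sum_sum_prod_pi {s : ℕ} {ι : Type*} [Fintype ι] (h : ι → ι → ℝ) :
    ∑ f : Fin s → ι, ∑ f' : Fin s → ι, ∏ k, h (f k) (f' k) = (∑ p, ∑ q, h p q) ^ s := by
  classical
  have h1 : ∀ f : Fin s → ι, ∑ f' : Fin s → ι, ∏ k, h (f k) (f' k) = ∏ k, ∑ q, h (f k) q := by
    intro f
    rw [Finset.prod_univ_sum, Fintype.piFinset_univ]
  simp_rw [h1]
  have h2 := Finset.prod_univ_sum (fun _ : Fin s => (Finset.univ : Finset ι))
    (fun _ p => ∑ q, h p q)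
  rw [Fintype.piFinset_univ] at h2
  rw [← h2]
  simp

theorem sum_exp_mul_sum_overlap {s b : ℕ} (hb : 1 ≤ b) (x : ℝ) :
    ∑ f : Fin s → Fin b × Bool, ∑ f' : Fin s → Fin b × Bool,
      Real.exp (x * ∑ k, overlap (f k) (f' k)) =
      ((b * 2 : ℝ) ^ s) ^ 2 * (1 + (Real.cosh x - 1) / b) ^ s := by
  simp_rw [Finset.mul_sum, Real.exp_sum]
  rw [sum_sum_prod_pi fun p q => Real.exp (x * overlap p q), sum_exp_mul_overlap hb, mul_pow]
  congr 1
  rw [← pow_mul, ← pow_mul, mul_comm s 2]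

/-- Uses `cosh u - 1 = e^{-u}(e^u - 1)² / 2` and `e^u - 1 ≤ u e^u`. -/
theorem cosh_sub_one_le {u : ℝ} (hu : 0 ≤ u) : Real.cosh u - 1 ≤ u ^ 2 / 2 * Real.exp u := by
  have h1 : Real.exp u - 1 ≤ u * Real.exp u := by
    have h := Real.add_one_le_exp (-u)
    have h2 : Real.exp (-u) * Real.exp u = 1 := by rw [← Real.exp_add]; simp
    nlinarith [Real.exp_pos u]
  have h0 : 0 ≤ Real.exp u - 1 := by linarith [Real.add_one_le_exp u]
  have h3 : Real.cosh u - 1 = Real.exp (-u) * (Real.exp u - 1) ^ 2 / 2 := by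
    have h2 : Real.exp (-u) * Real.exp u = 1 := by rw [← Real.exp_add]; simp
    rw [Real.cosh_eq]
    linear_combination (1 - Real.exp u / 2) * h2
  have h4 : (Real.exp u - 1) ^ 2 ≤ (u * Real.exp u) ^ 2 := pow_le_pow_left₀ h0 h1 2
  rw [h3]
  calc Real.exp (-u) * (Real.exp u - 1) ^ 2 / 2
      ≤ Real.exp (-u) * (u * Real.exp u) ^ 2 / 2 := by gcongr
    _ = u ^ 2 / 2 * (Real.exp (-u) * Real.exp u) * Real.exp u := by ring
    _ = u ^ 2 / 2 * Real.exp u := by rw [← Real.exp_add]; simp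

theorem cosh_le_exp {u : ℝ} (hu : 0 ≤ u) : Real.cosh u ≤ Real.exp u := by
  rw [Real.cosh_eq]
  have : Real.exp (-u) ≤ Real.exp u := Real.exp_le_exp.2 (by linarith)
  linarith

/-- The mixture over blocks of the moment generating function is at most Gaussian for moderate
arguments, and pays a small factor for large ones. -/
theorem one_add_cosh_pow_le {s b : ℕ} (hs : 1 ≤ s) (hb : 1 ≤ b) {a L : ℝ} (ha : 0 < a)
    (hL : 1 ≤ L) (hbL : (b : ℝ)⁻¹ ≤ 6 * Real.exp (-L)) (z : ℝ) :
    (1 + (Real.cosh (Real.sqrt (2 * (a * L / s)) * z) - 1) / b) ^ s ≤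
      Real.exp (6 * a * (L * Real.exp (-(L / 2))) * z ^ 2) +
        Real.exp (-(L / (64 * a))) * Real.exp ((4 * a + 1 / 8) * z ^ 2) := by
  have hs' : (1 : ℝ) ≤ s := by exact_mod_cast hs
  have hb' : (1 : ℝ) ≤ b := by exact_mod_cast hb
  set w := Real.sqrt (2 * (a * L / s)) * z with hw
  set u := |w| with hu
  have hu0 : 0 ≤ u := abs_nonneg _
  have hu2 : u ^ 2 = 2 * (a * L / s) * z ^ 2 := by
    rw [hu, sq_abs, hw, mul_pow, Real.sq_sqrt (by positivity)]
  rw [← Real.cosh_abs, ← hu]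
  have hc1 : 0 ≤ Real.cosh u - 1 := by linarith [Real.one_le_cosh u]
  have hbase : 0 ≤ 1 + (Real.cosh u - 1) / b := by positivity
  -- Up to `L / 2` the growth `e^u ≤ e^{L/2}` is absorbed by `1/b ≤ 6 e^{-L}`. Beyond it `z²` is at
  -- least of order `L / a`, which is rare under the Gaussian weight.
  rcases le_or_gt u (L / 2) with h | h
  · refine le_add_of_le_of_nonneg ?_ (by positivity)
    have h1 : (Real.cosh u - 1) / b ≤ 6 * a * (L * Real.exp (-(L / 2))) * z ^ 2 / s := by
      calc (Real.cosh u - 1) / b ≤ u ^ 2 / 2 * Real.exp u * (6 * Real.exp (-L)) := by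
            rw [div_eq_mul_inv]
            exact mul_le_mul (cosh_sub_one_le hu0) hbL (by positivity) (by positivity)
        _ ≤ u ^ 2 / 2 * Real.exp (L / 2) * (6 * Real.exp (-L)) := by gcongr
        _ = 6 * (u ^ 2 / 2) * (Real.exp (L / 2) * Real.exp (-L)) := by ring
        _ = 6 * a * (L * Real.exp (-(L / 2))) * z ^ 2 / s := by
            rw [hu2, ← Real.exp_add, show L / 2 + -L = -(L / 2) by ring]
            ring
    calc (1 + (Real.cosh u - 1) / b) ^ s
        ≤ (Real.exp (6 * a * (L * Real.exp (-(L / 2))) * z ^ 2 / s)) ^ s := by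
          refine pow_le_pow_left₀ hbase ?_ s
          linarith [Real.add_one_le_exp (6 * a * (L * Real.exp (-(L / 2))) * z ^ 2 / s)]
      _ = _ := by
          rw [← Real.exp_nat_mul]
          congr 1
          field_simp
  · refine le_add_of_nonneg_of_le (by positivity) ?_
    have hbc : 1 + (Real.cosh u - 1) / b ≤ Real.exp u := by
      have : (Real.cosh u - 1) / b ≤ Real.cosh u - 1 := div_le_self hc1 hb'
      linarith [cosh_le_exp hu0]
    have hsu : s * u ≤ 4 * a * z ^ 2 := by
      have h2 : s * u * (L / 2) ≤ s * u ^ 2 := by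
        rw [sq, ← mul_assoc]
        gcongr
      have h3 : (s : ℝ) * u ^ 2 = 2 * a * L * z ^ 2 := by
        rw [hu2]; field_simp
      rw [h3] at h2
      have hLpos : 0 < L / 2 := by linarith
      refine le_of_mul_le_mul_right ?_ hLpos
      linarith
    -- Here `z² ≥ L / (8a)`, so an extra `z² / 8` in the exponent pays for the factor `exp(-L /
    -- (64a))`.
    have hz : L / (64 * a) ≤ z ^ 2 / 8 := by
      have h4 : (L / 2) ^ 2 ≤ u ^ 2 := pow_le_pow_left₀ (by linarith) h.le 2
      have h5 : 2 * (a * L / s) * z ^ 2 ≤ 2 * (a * L) * z ^ 2 := by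
        gcongr
        exact div_le_self (by positivity) hs'
      rw [hu2] at h4
      have h6 : L * L ≤ L * (8 * a * z ^ 2) := by nlinarith
      have h7 : L ≤ 8 * a * z ^ 2 := le_of_mul_le_mul_left h6 (by linarith)
      rw [div_le_iff₀ (by positivity)]
      linarith
    calc (1 + (Real.cosh u - 1) / b) ^ s ≤ Real.exp u ^ s := pow_le_pow_left₀ hbase hbc s
      _ = Real.exp (s * u) := by rw [← Real.exp_nat_mul]
      _ ≤ _ := by
          rw [← Real.exp_add]
          refine Real.exp_le_exp.2 ?_
          linarith

/-- The first bound keeps the Gaussian integral convergent; the second supplies the decay in `L`. -/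
theorem mul_exp_neg_half_le {L : ℝ} (hL : 1 ≤ L) :
    L * Real.exp (-(L / 2)) ≤ 1 ∧ L * Real.exp (-(L / 2)) ≤ 8 / L := by
  have h := Real.quadratic_le_exp_of_nonneg (x := L / 2) (by linarith)
  rw [Real.exp_neg, ← div_eq_mul_inv]
  constructor
  · rw [div_le_one (Real.exp_pos _)]
    nlinarith [sq_nonneg (L - 2)]
  · rw [div_le_div_iff₀ (Real.exp_pos _) (by linarith)]
    nlinarith

theorem exp_neg_le_inv {y : ℝ} (hy : 0 < y) : Real.exp (-y) ≤ y⁻¹ := by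
  rw [Real.exp_neg]
  exact inv_anti₀ hy (by linarith [Real.add_one_le_exp y])

/-- Since `exp(r² S² / 2)` is the mean of `exp(r z S)` over standard Gaussian `z`, the square in the
exponent becomes linear in `S` and the sum over pairs factors over blocks for each `z`. -/
theorem sum_exp_overlap_sq_le {s b : ℕ} (hs : 1 ≤ s) (hb : 1 ≤ b) {a L : ℝ} (ha : 0 < a)
    (ha' : a ≤ 1 / 64) (hL : 1 ≤ L) (hbL : (b : ℝ)⁻¹ ≤ 6 * Real.exp (-L)) :
    ∑ f : Fin s → Fin b × Bool, ∑ f' : Fin s → Fin b × Bool,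
      Real.exp (a * L / s * (∑ k, overlap (f k) (f' k)) ^ 2) ≤
      ((b * 2 : ℝ) ^ s) ^ 2 * (1 + 224 * a / L) := by
  have hs' : (0 : ℝ) < s := by exact_mod_cast hs
  obtain ⟨hL1, hL2⟩ := mul_exp_neg_half_le hL
  set r := Real.sqrt (2 * (a * L / s)) with hr
  have hr2 : r ^ 2 = 2 * (a * L / s) := Real.sq_sqrt (by positivity)
  set N := ((b * 2 : ℝ) ^ s) ^ 2 with hN
  have hN0 : 0 ≤ N := by positivity
  set p := 6 * a * (L * Real.exp (-(L / 2))) with hp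
  have hp0 : 0 ≤ p := by positivity
  have hp1 : p ≤ 1 / 4 := by rw [hp]; nlinarith
  have hlin : ENNReal.ofReal (∑ f : Fin s → Fin b × Bool, ∑ f' : Fin s → Fin b × Bool,
      Real.exp (a * L / s * (∑ k, overlap (f k) (f' k)) ^ 2)) =
      ∫⁻ z, ENNReal.ofReal (N * (1 + (Real.cosh (r * z) - 1) / b) ^ s) ∂(gaussianReal 0 1) := by
    simp_rw [hN, ← sum_exp_mul_sum_overlap hb]
    have hnn : ∀ z (f : Fin s → Fin b × Bool),
        0 ≤ ∑ f' : Fin s → Fin b × Bool, Real.exp (r * z * ∑ k, overlap (f k) (f' k)) :=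
      fun z f => Finset.sum_nonneg fun _ _ => (Real.exp_pos _).le
    simp_rw [ENNReal.ofReal_sum_of_nonneg fun _ _ => hnn _ _,
      ENNReal.ofReal_sum_of_nonneg fun _ _ => (Real.exp_pos _).le]
    rw [ENNReal.ofReal_sum_of_nonneg
      fun _ _ => Finset.sum_nonneg fun _ _ => (Real.exp_pos _).le,
      lintegral_finsetSum _ fun _ _ => by fun_prop]
    refine Finset.sum_congr rfl fun f _ => ?_
    rw [ENNReal.ofReal_sum_of_nonneg fun _ _ => (Real.exp_pos _).le,
      lintegral_finsetSum _ fun _ _ => by fun_prop]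
    refine Finset.sum_congr rfl fun f' _ => ?_
    have h1 : ∀ z : ℝ, r * z * ∑ k, overlap (f k) (f' k) =
      (r * ∑ k, overlap (f k) (f' k)) * z := fun z => by ring
    simp_rw [h1]
    rw [lintegral_exp_mul_gaussianReal, mul_pow, hr2]
    congr 2
    ring
  have hbound : ENNReal.ofReal (∑ f : Fin s → Fin b × Bool, ∑ f' : Fin s → Fin b × Bool,
      Real.exp (a * L / s * (∑ k, overlap (f k) (f' k)) ^ 2)) ≤
      ENNReal.ofReal (N * ((Real.sqrt (1 - 2 * p))⁻¹ +
        Real.exp (-(L / (64 * a))) * (Real.sqrt (1 - 2 * (4 * a + 1 / 8)))⁻¹)) := by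
    rw [hlin]
    calc _ ≤ ∫⁻ z, (ENNReal.ofReal N * (ENNReal.ofReal (Real.exp (p * z ^ 2)) +
          ENNReal.ofReal (Real.exp (-(L / (64 * a)))) *
            ENNReal.ofReal (Real.exp ((4 * a + 1 / 8) * z ^ 2)))) ∂(gaussianReal 0 1) := by
          refine lintegral_mono fun z => ?_
          rw [← ENNReal.ofReal_mul (Real.exp_pos _).le,
            ← ENNReal.ofReal_add (Real.exp_pos _).le (by positivity),
            ← ENNReal.ofReal_mul hN0]
          exact ENNReal.ofReal_le_ofReal (mul_le_mul_of_nonneg_left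
            (one_add_cosh_pow_le hs hb ha hL hbL z) hN0)
      _ = _ := by
          rw [lintegral_const_mul _ (by fun_prop), lintegral_add_left (by fun_prop),
            lintegral_const_mul _ (by fun_prop), lintegral_exp_sq_gaussianReal (by linarith),
            lintegral_exp_sq_gaussianReal (by linarith), ← ENNReal.ofReal_mul (Real.exp_pos _).le,
            ← ENNReal.ofReal_add (by positivity) (by positivity), ← ENNReal.ofReal_mul hN0]
  rw [ENNReal.ofReal_le_ofReal_iff (by positivity)] at hbound
  refine hbound.trans (mul_le_mul_of_nonneg_left ?_ hN0)
  have h1 : (Real.sqrt (1 - 2 * p))⁻¹ ≤ 1 + 2 * p :=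
    inv_sqrt_one_sub_le (by linarith) (by linarith)
  have h2 : (Real.sqrt (1 - 2 * (4 * a + 1 / 8)))⁻¹ ≤ 1 + 2 * (4 * a + 1 / 8) :=
    inv_sqrt_one_sub_le (by linarith) (by linarith)
  have h3 : Real.exp (-(L / (64 * a))) ≤ 64 * a / L := by
    refine (exp_neg_le_inv (by positivity)).trans (le_of_eq ?_)
    rw [inv_div]
  have h4 : Real.exp (-(L / (64 * a))) * (Real.sqrt (1 - 2 * (4 * a + 1 / 8)))⁻¹ ≤
      64 * a / L * 2 :=
    mul_le_mul h3 (by linarith) (by positivity) (by positivity)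
  have h5 : p ≤ 48 * a / L := by
    rw [hp]
    calc 6 * a * (L * Real.exp (-(L / 2))) ≤ 6 * a * (8 / L) := by gcongr
      _ = 48 * a / L := by ring
  -- The constant is `224 = 2 · 48 + 64 · 2`, from moderate and large `z` respectively.
  calc _ ≤ 1 + 2 * (48 * a / L) + 64 * a / L * 2 := by linarith
    _ = 1 + 224 * a / L := by ring

/-! ### Block spikes and membership in the alternative class. -/

/-- The normalized signed indicator vector with one nonzero coordinate in every block; the
embedding `e` sends a block and a position in it to a coordinate. -/
noncomputable def blockSpike {s b d : ℕ} (e : Fin s × Fin b ↪ Fin d) (f : Fin s → Fin b × Bool) :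
    EuclideanSpace ℝ (Fin d) :=
  ∑ k, ((Real.sqrt s)⁻¹ * boolSign (f k).2) • EuclideanSpace.single (e (k, (f k).1)) (1 : ℝ)

theorem inner_blockSpike {s b d : ℕ} (e : Fin s × Fin b ↪ Fin d) (f f' : Fin s → Fin b × Bool) :
    inner ℝ (blockSpike e f) (blockSpike e f') = (∑ k, overlap (f k) (f' k)) / s := by
  unfold blockSpike
  simp_rw [sum_inner, inner_sum, real_inner_smul_left, real_inner_smul_right]
  rw [Finset.sum_div]
  refine Finset.sum_congr rfl fun k _ => ?_
  rw [Finset.sum_eq_single k]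
  · by_cases h : (f k).1 = (f' k).1
    · simp only [overlap, h, if_true, EuclideanSpace.inner_single_left, map_one,
        PiLp.single_apply]
      have : (Real.sqrt s)⁻¹ * (Real.sqrt s)⁻¹ = (s : ℝ)⁻¹ := by
        rw [← mul_inv, Real.mul_self_sqrt (Nat.cast_nonneg s)]
      rw [div_eq_mul_inv, ← this]
      ring
    · simp [overlap, h, EuclideanSpace.inner_single_left]
  · intro l _ hl
    simp [EuclideanSpace.inner_single_left, Ne.symm hl]
  · simp

theorem blockSpike_mem_sparseSphere {s b d : ℕ} (hs : 1 ≤ s) (e : Fin s × Fin b ↪ Fin d)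
    (f : Fin s → Fin b × Bool) : blockSpike e f ∈ sparseSphere s d := by
  constructor
  · have h1 : ∀ p : Fin b × Bool, overlap p p = 1 := by
      rintro ⟨i, c⟩
      cases c <;> simp [overlap, boolSign]
    have hs' : (s : ℝ) ≠ 0 := by positivity
    have h2 : ‖blockSpike e f‖ ^ 2 = 1 := by
      rw [← real_inner_self_eq_norm_sq, inner_blockSpike]
      simp [h1, hs']
    exact (pow_eq_one_iff_of_nonneg (norm_nonneg _) two_ne_zero).1 h2
  · have hsub : {i | blockSpike e f i ≠ 0} ⊆ Set.range fun k => e (k, (f k).1) := by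
      intro i hi
      by_contra hn
      refine hi ?_
      simp only [blockSpike, WithLp.ofLp_sum, Finset.sum_apply]
      refine Finset.sum_eq_zero fun k _ => ?_
      have : i ≠ e (k, (f k).1) := fun h => hn ⟨k, h.symm⟩
      simp [this]
    refine (Set.ncard_le_ncard hsub (Set.toFinite _)).trans ?_
    rw [← Set.image_univ]
    refine (Set.ncard_image_le (Set.toFinite _)).trans ?_
    simp [Set.ncard_univ]

theorem quadForm_eq_dotProduct {d : ℕ} (M : Matrix (Fin d) (Fin d) ℝ)
    (v : EuclideanSpace ℝ (Fin d)) :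
    quadForm M v = (v : Fin d → ℝ) ⬝ᵥ M *ᵥ (v : Fin d → ℝ) := by
  simp [quadForm, dotProduct, Matrix.mulVec, Finset.mul_sum, mul_assoc]

theorem quadForm_spikedCov {d : ℕ} (τ : ℝ) (v w : EuclideanSpace ℝ (Fin d)) :
    quadForm (spikedCov τ v) w = ‖w‖ ^ 2 + τ ^ 2 * (inner ℝ v w) ^ 2 := by
  rw [quadForm_eq_dotProduct, dotProduct_spikedCov]

theorem spikedCov_zero {d : ℕ} (v : EuclideanSpace ℝ (Fin d)) : spikedCov 0 v = 1 := by
  simp [spikedCov]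

theorem inner_sq_le_one {d : ℕ} {v w : EuclideanSpace ℝ (Fin d)} (hv : ‖v‖ = 1) (hw : ‖w‖ = 1) :
    (inner ℝ v w) ^ 2 ≤ 1 := by
  have h := abs_real_inner_le_norm v w
  rw [hv, hw, mul_one] at h
  exact (sq_le_one_iff_abs_le_one _).2 h

theorem spikedCov_wellConditioned {s d : ℕ} {C τ : ℝ} {v : EuclideanSpace ℝ (Fin d)}
    (hv : v ∈ sparseSphere s d) (hC : 1 + τ ^ 2 ≤ C) :
    (spikedCov τ v).PosSemidef ∧ 0 < sparseEigMin s (spikedCov τ v) ∧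
      sparseEigMax s (spikedCov τ v) / sparseEigMin s (spikedCov τ v) ≤ C := by
  have : Nonempty (sparseSphere s d) := ⟨⟨v, hv⟩⟩
  have h1 : 1 ≤ sparseEigMin s (spikedCov τ v) := by
    refine le_ciInf fun w => ?_
    rw [quadForm_spikedCov, w.2.1]
    nlinarith [mul_nonneg (sq_nonneg τ) (sq_nonneg (inner ℝ v (w : EuclideanSpace ℝ (Fin d))))]
  have h2 : sparseEigMax s (spikedCov τ v) ≤ 1 + τ ^ 2 := by
    refine ciSup_le fun w => ?_
    rw [quadForm_spikedCov, w.2.1]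
    nlinarith [mul_le_mul_of_nonneg_left (inner_sq_le_one hv.1 w.2.1) (sq_nonneg τ)]
  refine ⟨(posDef_spikedCov τ v).posSemidef, by linarith, ?_⟩
  rw [div_le_iff₀ (by linarith)]
  nlinarith [sq_nonneg τ]

/-- At the direction `v` the ratio is `τ² / (q + τ² / m)` with `q = 1/n + 1/m`. As `τ² ≤ 1`, this is
at least `τ² / (2q)`, whence the factor `2` in `hτ`. -/
theorem one_spikedCov_mem_alternatives {n m s d : ℕ} {C lam τ : ℝ}
    {v : EuclideanSpace ℝ (Fin d)} (hn : 0 < n) (hm : 0 < m) (hv : v ∈ sparseSphere s d)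
    (hC : 1 + τ ^ 2 ≤ C) (hτ1 : τ ^ 2 ≤ 1)
    (hτ : 2 * lam * Real.sqrt (((n : ℝ) + m) / ((n : ℝ) * m)) * rate s d ≤ τ ^ 2) :
    ((1, spikedCov τ v) : Matrix (Fin d) (Fin d) ℝ × Matrix (Fin d) (Fin d) ℝ) ∈
      alternatives C lam n m s d := by
  have hn' : (0 : ℝ) < n := by exact_mod_cast hn
  have hm' : (0 : ℝ) < m := by exact_mod_cast hm
  have h0 := spikedCov_wellConditioned (C := C) (τ := 0) hv (by nlinarith [sq_nonneg τ])
  rw [spikedCov_zero] at h0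
  refine ⟨h0, spikedCov_wellConditioned hv hC, ?_⟩
  have hnum : ∀ w ∈ sparseSphere s d, quadForm ((1 : Matrix (Fin d) (Fin d) ℝ) - spikedCov τ v) w =
      -(τ ^ 2 * (inner ℝ v w) ^ 2) := by
    intro w hw
    rw [quadForm_eq_dotProduct, Matrix.sub_mulVec, dotProduct_sub, ← spikedCov_zero v,
      dotProduct_spikedCov, dotProduct_spikedCov]
    ring
  have hden : ∀ w ∈ sparseSphere s d,
      quadForm ((n : ℝ)⁻¹ • (1 : Matrix (Fin d) (Fin d) ℝ) + (m : ℝ)⁻¹ • spikedCov τ v) w =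
      (n : ℝ)⁻¹ + (m : ℝ)⁻¹ * (1 + τ ^ 2 * (inner ℝ v w) ^ 2) := by
    intro w hw
    rw [quadForm_eq_dotProduct, Matrix.add_mulVec, dotProduct_add, ← spikedCov_zero v,
      Matrix.smul_mulVec, Matrix.smul_mulVec, dotProduct_smul, dotProduct_smul,
      dotProduct_spikedCov, dotProduct_spikedCov, hw.1]
    simp
  set q := ((n : ℝ) + m) / ((n : ℝ) * m) with hq
  have hq0 : 0 < q := by positivity
  have hq1 : q = (n : ℝ)⁻¹ + (m : ℝ)⁻¹ := by rw [hq]; field_simp; ring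
  -- An unbounded real supremum would take the default value `0`, so boundedness is needed to
  -- compare with the value at `v`.
  have hbdd : BddAbove (Set.range fun w : sparseSphere s d =>
      |quadForm ((1 : Matrix (Fin d) (Fin d) ℝ) - spikedCov τ v) w /
        quadForm ((n : ℝ)⁻¹ • (1 : Matrix (Fin d) (Fin d) ℝ) + (m : ℝ)⁻¹ • spikedCov τ v) w|) := by
    refine ⟨1 / q, ?_⟩
    rintro _ ⟨w, rfl⟩
    simp only
    have hx0 : 0 ≤ τ ^ 2 * (inner ℝ v (w : EuclideanSpace ℝ (Fin d))) ^ 2 := by positivity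
    have hx1 : τ ^ 2 * (inner ℝ v (w : EuclideanSpace ℝ (Fin d))) ^ 2 ≤ 1 :=
      mul_le_one₀ hτ1 (sq_nonneg _) (inner_sq_le_one hv.1 w.2.1)
    rw [hnum w w.2, hden w w.2, abs_div, abs_neg, abs_of_nonneg hx0, abs_of_nonneg (by positivity)]
    refine div_le_div₀ zero_le_one hx1 hq0 ?_
    rw [hq1]
    have : 0 ≤ (m : ℝ)⁻¹ * (τ ^ 2 * (inner ℝ v (w : EuclideanSpace ℝ (Fin d))) ^ 2) := by positivity
    linarith
  have hle := le_ciSup hbdd ⟨v, hv⟩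
  simp only at hle
  rw [hnum v hv, hden v hv, real_inner_self_eq_norm_sq, hv.1, abs_div, abs_neg] at hle
  simp only [one_pow, mul_one] at hle
  rw [abs_of_nonneg (sq_nonneg τ), abs_of_nonneg (by positivity)] at hle
  have hle2 : τ ^ 2 / (2 * q) ≤ τ ^ 2 / ((n : ℝ)⁻¹ + (m : ℝ)⁻¹ * (1 + τ ^ 2)) := by
    refine div_le_div_of_nonneg_left (sq_nonneg τ) (by positivity) ?_
    rw [hq1]
    have h1 : (m : ℝ)⁻¹ * τ ^ 2 ≤ (m : ℝ)⁻¹ * 1 := by gcongr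
    have h2 : 0 < (n : ℝ)⁻¹ := by positivity
    linarith
  have hsq : Real.sqrt q * Real.sqrt q = q := Real.mul_self_sqrt hq0.le
  have hsq0 : 0 < Real.sqrt q := Real.sqrt_pos.2 hq0
  unfold separation
  rw [← hq]
  refine le_trans ?_ (mul_le_mul_of_nonneg_left (hle2.trans hle) hsq0.le)
  rw [mul_div_assoc', le_div_iff₀ (by positivity)]
  calc lam * rate s d * (2 * q) = Real.sqrt q * (2 * lam * Real.sqrt q * rate s d) := by
        linear_combination (-2 * lam * rate s d) * hsq
    _ ≤ Real.sqrt q * τ ^ 2 := by gcongr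

/-! ### Le Cam's method for the two-sample problem. -/

/-- The likelihood ratio of the two samples when the second population is spiked. -/
noncomputable def sampleDensity (n m : ℕ) {d : ℕ} (τ : ℝ) (v : EuclideanSpace ℝ (Fin d))
    (x : Sample n m d) : ℝ≥0∞ :=
  ∏ j, spikeDensity τ v (x.2 j)

theorem measurable_sampleDensity (n m : ℕ) {d : ℕ} (τ : ℝ) (v : EuclideanSpace ℝ (Fin d)) :
    Measurable (sampleDensity n m τ v) :=
  Finset.measurable_prod _ fun j _ =>
    (measurable_spikeDensity τ v).comp ((measurable_pi_apply j).comp measurable_snd)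

theorem sampleLaw_spikedCov (n m : ℕ) {d : ℕ} (τ : ℝ) (v : EuclideanSpace ℝ (Fin d)) :
    sampleLaw n m (multivariateGaussian 0 (1 : Matrix (Fin d) (Fin d) ℝ))
        (multivariateGaussian 0 (spikedCov τ v)) =
      (sampleLaw n m (stdGaussian (EuclideanSpace ℝ (Fin d)))
        (stdGaussian (EuclideanSpace ℝ (Fin d)))).withDensity (sampleDensity n m τ v) := by
  have : IsProbabilityMeasure ((stdGaussian (EuclideanSpace ℝ (Fin d))).withDensity
      (spikeDensity τ v)) := by
    rw [← multivariateGaussian_spikedCov]; infer_instance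
  have hpi := pi_withDensity (fun _ : Fin m => stdGaussian (EuclideanSpace ℝ (Fin d)))
    (fun _ => measurable_spikeDensity τ v)
  have hm : Measurable fun y : Fin m → EuclideanSpace ℝ (Fin d) => ∏ j, spikeDensity τ v (y j) :=
    Finset.measurable_prod _ fun j _ => (measurable_spikeDensity τ v).comp (measurable_pi_apply j)
  have hsf : SFinite ((Measure.pi fun _ : Fin m => stdGaussian (EuclideanSpace ℝ (Fin d))).withDensity
      fun y => ∏ j, spikeDensity τ v (y j)) := by
    rw [← hpi]; infer_instance
  unfold sampleLaw
  rw [multivariateGaussian_zero_one, multivariateGaussian_spikedCov, hpi,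
    prod_withDensity_right hm]
  rfl

theorem lintegral_sampleDensity (n m : ℕ) {d : ℕ} (τ : ℝ) (v : EuclideanSpace ℝ (Fin d)) :
    ∫⁻ x, sampleDensity n m τ v x ∂(sampleLaw n m (stdGaussian (EuclideanSpace ℝ (Fin d)))
        (stdGaussian (EuclideanSpace ℝ (Fin d)))) = 1 := by
  have hm : Measurable fun y : Fin m → EuclideanSpace ℝ (Fin d) => ∏ j, spikeDensity τ v (y j) :=
    Finset.measurable_prod _ fun j _ => (measurable_spikeDensity τ v).comp (measurable_pi_apply j)
  have h := (measurePreserving_snd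
    (μ := Measure.pi fun _ : Fin n => stdGaussian (EuclideanSpace ℝ (Fin d)))
    (ν := Measure.pi fun _ : Fin m => stdGaussian (EuclideanSpace ℝ (Fin d)))).lintegral_comp hm
  unfold sampleDensity sampleLaw
  rw [h, lintegral_pi_prod _ fun _ => measurable_spikeDensity τ v]
  simp [lintegral_spikeDensity]

theorem lintegral_sampleDensity_mul_le (n m : ℕ) {d : ℕ} (τ : ℝ)
    (v v' : EuclideanSpace ℝ (Fin d)) (hv : (τ ^ 2 * inner ℝ v v') ^ 2 ≤ 1 / 2) :
    ∫⁻ x, sampleDensity n m τ v x * sampleDensity n m τ v' x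
        ∂(sampleLaw n m (stdGaussian (EuclideanSpace ℝ (Fin d)))
          (stdGaussian (EuclideanSpace ℝ (Fin d)))) ≤
      ENNReal.ofReal (Real.exp (m * (τ ^ 2 * inner ℝ v v') ^ 2)) := by
  have hm1 : Measurable fun y => spikeDensity τ v y * spikeDensity τ v' y :=
    (measurable_spikeDensity τ v).mul (measurable_spikeDensity τ v')
  have hm : Measurable fun y : Fin m → EuclideanSpace ℝ (Fin d) =>
      ∏ j, (spikeDensity τ v (y j) * spikeDensity τ v' (y j)) :=
    Finset.measurable_prod _ fun j _ => hm1.comp (measurable_pi_apply j)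
  have h := (measurePreserving_snd
    (μ := Measure.pi fun _ : Fin n => stdGaussian (EuclideanSpace ℝ (Fin d)))
    (ν := Measure.pi fun _ : Fin m => stdGaussian (EuclideanSpace ℝ (Fin d)))).lintegral_comp hm
  unfold sampleDensity sampleLaw
  simp_rw [← Finset.prod_mul_distrib]
  rw [h, lintegral_pi_prod (fun _ => stdGaussian (EuclideanSpace ℝ (Fin d))) fun _ => hm1,
    Finset.prod_const, Finset.card_univ, Fintype.card_fin, Real.exp_nat_mul,
    ENNReal.ofReal_pow (Real.exp_pos _).le]
  exact pow_le_pow_left' (lintegral_spikeDensity_mul_le τ v v' hv) m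

/-- Le Cam's method for the uniform prior on a finite family of spikes. -/
theorem le_minimaxTypeII_of_spikes {n m s d : ℕ} {C lam α τ δ : ℝ} {𝓜 : Model}
    (h𝓜 : 𝓜.IsAdmissible) (hα : 0 < α) (hδ : 0 < δ)
    {ι : Type*} [Fintype ι] [Nonempty ι] (v : ι → EuclideanSpace ℝ (Fin d))
    (halt : ∀ i, ((1, spikedCov τ (v i)) : Matrix (Fin d) (Fin d) ℝ × Matrix (Fin d) (Fin d) ℝ) ∈
      alternatives C lam n m s d)
    (hv : ∀ i j, (τ ^ 2 * inner ℝ (v i) (v j)) ^ 2 ≤ 1 / 2)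
    (hsum : ∑ i, ∑ j, Real.exp (m * (τ ^ 2 * inner ℝ (v i) (v j)) ^ 2) ≤
      (Fintype.card ι : ℝ) ^ 2 * (1 + δ ^ 2)) :
    ENNReal.ofReal (1 - α - δ) ≤ minimaxTypeII 𝓜 α C lam n m s d := by
  unfold minimaxTypeII
  refine le_iInf₂ fun Φ hΦ => ?_
  set sup := ⨆ S ∈ alternatives C lam n m s d,
    ⨆ P ∈ 𝓜 d S.1, ⨆ Q ∈ 𝓜 d S.2, sampleLaw n m P Q {x | Φ x = 0} with hsup
  set P₀ := sampleLaw n m (stdGaussian (EuclideanSpace ℝ (Fin d)))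
        (stdGaussian (EuclideanSpace ℝ (Fin d))) with hP₀
  have hprob : IsProbabilityMeasure P₀ := by rw [hP₀]; unfold sampleLaw; infer_instance
  have hA : MeasurableSet {x | Φ x = 0} := hΦ.1 (measurableSet_singleton 0)
  have hG : multivariateGaussian 0 (1 : Matrix (Fin d) (Fin d) ℝ) ∈ 𝓜 d 1 :=
    h𝓜.2 d 1 Matrix.PosDef.one
  have hle : ∀ i, P₀.withDensity (sampleDensity n m τ (v i)) {x | Φ x = 0} ≤ sup := by
    intro i
    rw [← sampleLaw_spikedCov]
    exact le_iSup₂_of_le _ (halt i) (le_iSup₂_of_le _ hG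
      (le_iSup₂_of_le _ (h𝓜.2 d _ (posDef_spikedCov τ (v i))) le_rfl))
  have hnull : ENNReal.ofReal (1 - α) ≤ P₀ {x | Φ x = 0} := by
    have h1 := hΦ.2 1 _ hG _ hG
    rw [multivariateGaussian_zero_one, ← hP₀] at h1
    have h2 : {x | Φ x = 1} = {x | Φ x = 0}ᶜ := by
      ext x
      simp only [Set.mem_ofPred_eq, Set.mem_compl_iff]
      generalize Φ x = c
      fin_cases c <;> simp
    rw [h2, prob_compl_eq_one_sub hA, tsub_le_iff_right] at h1
    rw [ENNReal.ofReal_sub _ hα.le, ENNReal.ofReal_one, tsub_le_iff_left]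
    exact h1
  set N : ℝ≥0∞ := (Fintype.card ι : ℝ≥0∞) with hN
  have hN0 : N ≠ 0 := by simp [hN]
  have hNt : N ≠ ∞ := ENNReal.natCast_ne_top _
  have hmeas := fun i => measurable_sampleDensity n m τ (v i)
  -- The likelihood ratio of the uniform mixture over the spikes.
  set F : Sample n m d → ℝ≥0∞ := fun x => N⁻¹ * ∑ i, sampleDensity n m τ (v i) x with hF
  have hFm : Measurable F := (Finset.measurable_sum _ fun i _ => hmeas i).const_mul _
  have hF1 : ∫⁻ x, F x ∂P₀ = 1 := by
    simp_rw [hF]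
    rw [lintegral_const_mul _ (Finset.measurable_sum _ fun i _ => hmeas i),
      lintegral_finsetSum _ fun i _ => hmeas i]
    simp_rw [hP₀, lintegral_sampleDensity]
    simp only [Finset.sum_const, Finset.card_univ, nsmul_eq_mul, mul_one]
    exact ENNReal.inv_mul_cancel hN0 hNt
  have hprod : ∀ i j, Measurable fun x =>
      sampleDensity n m τ (v i) x * sampleDensity n m τ (v j) x := fun i j => (hmeas i).mul (hmeas j)
  have hF2 : ∫⁻ x, F x * F x ∂P₀ ≤ ENNReal.ofReal (1 + δ ^ 2) := by
    have h1 : ∀ x, F x * F x = N⁻¹ * N⁻¹ *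
        ∑ i, ∑ j, sampleDensity n m τ (v i) x * sampleDensity n m τ (v j) x := by
      intro x
      rw [← Finset.sum_mul_sum]
      simp only [hF]
      ring
    simp_rw [h1]
    rw [lintegral_const_mul _ (Finset.measurable_sum _ fun i _ => Finset.measurable_sum _
        fun j _ => hprod i j),
      lintegral_finsetSum _ fun i _ => Finset.measurable_sum _
        fun j _ => hprod i j]
    have h2 : ∑ i, ∫⁻ x, ∑ j, sampleDensity n m τ (v i) x * sampleDensity n m τ (v j) x ∂P₀ ≤
        N * N * ENNReal.ofReal (1 + δ ^ 2) := by
      calc _ ≤ ∑ i, ∑ j, ENNReal.ofReal (Real.exp (m * (τ ^ 2 * inner ℝ (v i) (v j)) ^ 2)) := by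
            refine Finset.sum_le_sum fun i _ => ?_
            rw [lintegral_finsetSum _ fun j _ => hprod i j]
            exact Finset.sum_le_sum fun j _ =>
              lintegral_sampleDensity_mul_le n m τ (v i) (v j) (hv i j)
        _ = ENNReal.ofReal (∑ i, ∑ j, Real.exp (m * (τ ^ 2 * inner ℝ (v i) (v j)) ^ 2)) := by
            rw [ENNReal.ofReal_sum_of_nonneg
              fun _ _ => Finset.sum_nonneg fun _ _ => (Real.exp_pos _).le]
            refine Finset.sum_congr rfl fun i _ => ?_
            rw [ENNReal.ofReal_sum_of_nonneg fun _ _ => (Real.exp_pos _).le]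
        _ ≤ ENNReal.ofReal ((Fintype.card ι : ℝ) ^ 2 * (1 + δ ^ 2)) :=
            ENNReal.ofReal_le_ofReal hsum
        _ = _ := by
            rw [ENNReal.ofReal_mul (by positivity), ENNReal.ofReal_pow (by positivity),
              ENNReal.ofReal_natCast, sq]
    refine (mul_le_mul' le_rfl h2).trans (le_of_eq ?_)
    have h3 := ENNReal.inv_mul_cancel hN0 hNt
    calc N⁻¹ * N⁻¹ * (N * N * ENNReal.ofReal (1 + δ ^ 2))
        = (N⁻¹ * N) * (N⁻¹ * N) * ENNReal.ofReal (1 + δ ^ 2) := by ring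
      _ = _ := by rw [h3, one_mul, one_mul]
  -- The mixture's type-II error is an average of errors at alternatives.
  have hmix : P₀.withDensity F {x | Φ x = 0} ≤ sup := by
    rw [withDensity_apply _ hA]
    simp only [hF]
    rw [lintegral_const_mul _ (Finset.measurable_sum _ fun i _ => hmeas i),
      lintegral_finsetSum _ fun i _ => hmeas i]
    calc _ ≤ N⁻¹ * ∑ _i : ι, sup := by
          refine mul_le_mul' le_rfl (Finset.sum_le_sum fun i _ => ?_)
          rw [← withDensity_apply _ hA]
          exact hle i
      _ = (N⁻¹ * N) * sup := by
          simp only [Finset.sum_const, Finset.card_univ, nsmul_eq_mul]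
          ring
      _ = sup := by rw [ENNReal.inv_mul_cancel hN0 hNt, one_mul]
  have hkey := measure_le_withDensity_add P₀ hFm hF1 hδ hF2 hA
  rw [ENNReal.ofReal_sub _ hδ.le, tsub_le_iff_right]
  exact hnull.trans (hkey.trans (add_le_add hmix le_rfl))

/-! ### Choice of parameters and the asymptotic regime. -/

theorem one_le_log_exp_mul_div {s d : ℕ} (hs : 1 ≤ s) (hsd : s ≤ d) :
    1 ≤ Real.log (Real.exp 1 * d / s) := by
  have hs' : (0 : ℝ) < s := by exact_mod_cast hs
  have hsd' : (s : ℝ) ≤ d := by exact_mod_cast hsd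
  have hd' : (0 : ℝ) < d := hs'.trans_le hsd'
  rw [Real.le_log_iff_exp_le (by positivity), le_div_iff₀ hs']
  gcongr

theorem exp_neg_log_exp_mul_div {s d : ℕ} (hs : 1 ≤ s) (hsd : s ≤ d) :
    Real.exp (-Real.log (Real.exp 1 * d / s)) = s / (Real.exp 1 * d) := by
  have hs' : (0 : ℝ) < s := by exact_mod_cast hs
  have hsd' : (s : ℝ) ≤ d := by exact_mod_cast hsd
  have hd' : (0 : ℝ) < d := hs'.trans_le hsd'
  rw [Real.exp_neg, Real.exp_log (by positivity), inv_div]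

/-- The constant `6` combines `d ≤ 2 s ⌊d/s⌋` with `e < 3`. -/
theorem inv_natDiv_le {s d : ℕ} (hs : 1 ≤ s) (hsd : s ≤ d) :
    ((d / s : ℕ) : ℝ)⁻¹ ≤ 6 * Real.exp (-Real.log (Real.exp 1 * d / s)) := by
  have hs' : (0 : ℝ) < s := by exact_mod_cast hs
  have hsd' : (s : ℝ) ≤ d := by exact_mod_cast hsd
  have hd' : (0 : ℝ) < d := hs'.trans_le hsd'
  have hb : 1 ≤ d / s := (Nat.one_le_div_iff hs).2 hsd
  have hb' : (0 : ℝ) < ((d / s : ℕ) : ℝ) := by exact_mod_cast hb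
  have h1 : d ≤ 2 * s * (d / s) := by
    have h := Nat.lt_mul_div_succ d hs
    nlinarith
  have h2 : (d : ℝ) ≤ 2 * s * (d / s : ℕ) := by exact_mod_cast h1
  rw [exp_neg_log_exp_mul_div hs hsd, inv_le_iff_one_le_mul₀ hb', mul_div_assoc', div_mul_eq_mul_div,
    le_div_iff₀ (by positivity), one_mul]
  have h3 : Real.exp 1 * d ≤ 3 * (2 * s * (d / s : ℕ)) :=
    mul_le_mul Real.exp_one_lt_three.le h2 hd'.le (by norm_num)
  linarith

/-- The nonasymptotic lower bound. -/
theorem le_minimaxTypeII {n m s d : ℕ} {C lam α δ : ℝ} {𝓜 : Model}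
    (h𝓜 : 𝓜.IsAdmissible) (hα : 0 < α) (hδ : 0 < δ) (hn : 0 < n) (hm : 0 < m) (hs : 1 ≤ s)
    (hsd : s ≤ d) (hlam : 0 < lam)
    (hcond : 4 * lam ^ 2 * (((n : ℝ) + m) / ((n : ℝ) * m)) *
      (s * Real.log (Real.exp 1 * d / s)) ≤ min (1 / 2) ((C - 1) ^ 2)) (hC : 1 < C)
    (hlam1 : 4 * lam ^ 2 * (1 + (m : ℝ) / n) ≤ 1 / 64)
    (hχ : 224 * (4 * lam ^ 2 * (1 + (m : ℝ) / n)) / Real.log (Real.exp 1 * d / s) ≤ δ ^ 2) :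
    ENNReal.ofReal (1 - α - δ) ≤ minimaxTypeII 𝓜 α C lam n m s d := by
  have hs' : (0 : ℝ) < s := by exact_mod_cast hs
  have hn' : (0 : ℝ) < n := by exact_mod_cast hn
  have hm' : (0 : ℝ) < m := by exact_mod_cast hm
  have hb : 1 ≤ d / s := (Nat.one_le_div_iff hs).2 hsd
  have hL := one_le_log_exp_mul_div hs hsd
  have hbL := inv_natDiv_le hs hsd
  have hrate : rate s d = Real.sqrt (s * Real.log (Real.exp 1 * d / s)) := rfl
  set L := Real.log (Real.exp 1 * d / s)
  set q := ((n : ℝ) + m) / ((n : ℝ) * m) with hq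
  have hq0 : 0 < q := by positivity
  set a := 4 * lam ^ 2 * (1 + (m : ℝ) / n) with ha
  have hamq : a = 4 * lam ^ 2 * q * m := by rw [ha, hq]; field_simp
  have ha0 : 0 < a := by positivity
  -- The spike strength `τ²`, the least that `one_spikedCov_mem_alternatives` accepts; it satisfies
  -- `m θ² = a s L`.
  set θ := 2 * lam * Real.sqrt q * rate s d with hθ
  have hθ0 : 0 ≤ θ := by rw [hθ, hrate]; positivity
  have hθ2 : θ ^ 2 = 4 * lam ^ 2 * q * (s * L) := by
    rw [hθ, hrate, mul_pow, mul_pow, Real.sq_sqrt hq0.le,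
      Real.sq_sqrt (mul_nonneg hs'.le (by linarith))]
    ring
  rw [← hθ2] at hcond
  have hθ3 : θ ^ 2 ≤ 1 / 2 := hcond.trans (min_le_left _ _)
  have hθ4 : θ ≤ C - 1 := abs_le_of_sq_le_sq' (hcond.trans (min_le_right _ _)) (by linarith) |>.2
  have hτ : Real.sqrt θ ^ 2 = θ := Real.sq_sqrt hθ0
  -- The blocks fill the first `s ⌊d/s⌋` coordinates; any remaining ones stay zero.
  set e : Fin s × Fin (d / s) ↪ Fin d :=
    finProdFinEquiv.toEmbedding.trans (Fin.castLEEmb (Nat.mul_div_le d s))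
  have : Nonempty (Fin s → Fin (d / s) × Bool) := ⟨fun _ => (⟨0, hb⟩, true)⟩
  have hmem := blockSpike_mem_sparseSphere hs e
  refine le_minimaxTypeII_of_spikes h𝓜 hα hδ (τ := Real.sqrt θ) (blockSpike e) (fun f => ?_)
    (fun f f' => ?_) ?_
  · refine one_spikedCov_mem_alternatives hn hm (hmem f) ?_ ?_ ?_
    · rw [hτ]; linarith
    · rw [hτ]; nlinarith
    · rw [hτ]
  · rw [hτ, mul_pow]
    have := inner_sq_le_one (hmem f).1 (hmem f').1
    nlinarith [sq_nonneg θ]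
  · have hexp : ∀ f f' : Fin s → Fin (d / s) × Bool,
        m * (Real.sqrt θ ^ 2 * inner ℝ (blockSpike e f) (blockSpike e f')) ^ 2 =
          a * L / s * (∑ k, overlap (f k) (f' k)) ^ 2 := by
      intro f f'
      rw [hτ, inner_blockSpike, mul_pow, hθ2, hamq, div_pow]
      field_simp
    simp_rw [hexp]
    refine (sum_exp_overlap_sq_le hs hb ha0 hlam1 hL hbL).trans ?_
    have hcard : (Fintype.card (Fin s → Fin (d / s) × Bool) : ℝ) = ((d / s : ℕ) * 2 : ℝ) ^ s := by
      simp
    rw [hcard]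
    gcongr

/-- For `n ≥ 3` the factor `log n` is at least one and can be dropped. -/
theorem Regime.eventually_mul_log_le {κ : ℝ} {m d s : ℕ → ℕ} (h : Regime κ m d s) {c : ℝ}
    (hc : 0 < c) :
    ∀ᶠ n : ℕ in atTop, s n * Real.log (Real.exp 1 * d n / s n) ≤ c * n := by
  filter_upwards [h.scaling.def hc, eventually_ge_atTop 3] with n hn h3
  have hL := one_le_log_exp_mul_div (h.one_le n) (h.le_dim n)
  have hlog : 1 ≤ Real.log n := by
    have h3' : (3 : ℝ) ≤ n := by exact_mod_cast h3
    rw [Real.le_log_iff_exp_le (by linarith)]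
    linarith [Real.exp_one_lt_three]
  have h0 : 0 ≤ s n * Real.log (Real.exp 1 * d n / s n) := by positivity
  rw [Real.norm_of_nonneg (by positivity), Real.norm_of_nonneg (by positivity)] at hn
  exact (le_mul_of_one_le_right h0 hlog).trans hn

theorem Regime.eventually_le_minimaxTypeII {κ : ℝ} {m d s : ℕ → ℕ} (h : Regime κ m d s)
    {C lam α δ : ℝ} {𝓜 : Model} (h𝓜 : 𝓜.IsAdmissible) (hα : 0 < α) (hδ : 0 < δ) (hC : 1 < C)
    (hlam : 0 < lam) (hlam1 : 4 * lam ^ 2 * (1 + κ) ≤ 1 / 64)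
    (hχ : ∀ᶠ n : ℕ in atTop, 224 * (4 * lam ^ 2 * (1 + κ)) /
      Real.log (Real.exp 1 * d n / s n) ≤ δ ^ 2) :
    ∀ᶠ n : ℕ in atTop,
      ENNReal.ofReal (1 - α - δ) ≤ minimaxTypeII 𝓜 α C lam n (m n) (s n) (d n) := by
  have hc : 0 < min (1 / 2) ((C - 1) ^ 2) := lt_min (by norm_num) (pow_pos (by linarith) 2)
  filter_upwards [h.eventually_mul_log_le hc, h.comparable, hχ, eventually_gt_atTop 0]
    with n hn ⟨hnm, hmn⟩ hχn hpos
  have hn' : (0 : ℝ) < n := by exact_mod_cast hpos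
  have hm : 0 < m n := by
    rcases Nat.eq_zero_or_pos (m n) with h0 | h0
    · rw [h0] at hnm
      simp at hnm
      omega
    · exact h0
  have hm' : (0 : ℝ) < m n := by exact_mod_cast hm
  have hL := one_le_log_exp_mul_div (h.one_le n) (h.le_dim n)
  have hdiv : (m n : ℝ) / n ≤ κ := by rwa [div_le_iff₀ hn']
  have hdiv' : (n : ℝ) / m n ≤ κ := by rwa [div_le_iff₀ hm']
  have ha : 4 * lam ^ 2 * (1 + (m n : ℝ) / n) ≤ 4 * lam ^ 2 * (1 + κ) := by gcongr
  refine le_minimaxTypeII h𝓜 hα hδ hpos hm (h.one_le n) (h.le_dim n) hlam ?_ hC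
    (ha.trans hlam1) (le_trans ?_ hχn)
  · have hq : ((n : ℝ) + m n) / ((n : ℝ) * m n) = (1 + (n : ℝ) / m n) / n := by
      field_simp
      ring
    calc 4 * lam ^ 2 * (((n : ℝ) + m n) / ((n : ℝ) * m n)) *
          (s n * Real.log (Real.exp 1 * d n / s n))
        ≤ 4 * lam ^ 2 * (((n : ℝ) + m n) / ((n : ℝ) * m n)) *
          (min (1 / 2) ((C - 1) ^ 2) * n) := by gcongr
      _ = 4 * lam ^ 2 * (1 + (n : ℝ) / m n) * min (1 / 2) ((C - 1) ^ 2) := by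
          rw [hq]
          field_simp
      _ ≤ 1 * min (1 / 2) ((C - 1) ^ 2) := by
          refine mul_le_mul_of_nonneg_right ?_ hc.le
          have : 4 * lam ^ 2 * (1 + (n : ℝ) / m n) ≤ 4 * lam ^ 2 * (1 + κ) := by gcongr
          linarith
      _ = _ := one_mul _
  · gcongr

theorem four_mul_sq_mul_le_of_le_sqrt {κ c lam : ℝ} (hκ : 0 < κ) (hc : 0 ≤ c) (hlam : 0 < lam)
    (h : lam ≤ Real.sqrt (c / (4 * (1 + κ)))) : 4 * lam ^ 2 * (1 + κ) ≤ c := by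
  have h1 := (Real.le_sqrt hlam.le (by positivity)).1 h
  rw [le_div_iff₀ (by positivity)] at h1
  linarith

theorem eventually_le_log_of_tendsto_div {κ : ℝ} {m d s : ℕ → ℕ} (h : Regime κ m d s)
    (hsd : Tendsto (fun n : ℕ => (s n : ℝ) / d n) atTop (𝓝 0)) (K : ℝ) :
    ∀ᶠ n : ℕ in atTop, K ≤ Real.log (Real.exp 1 * d n / s n) := by
  filter_upwards [hsd.eventually (eventually_le_nhds (Real.exp_pos (-K)))] with n hn
  have hs' : (0 : ℝ) < s n := by exact_mod_cast h.one_le n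
  have hd' : (0 : ℝ) < d n := by exact_mod_cast (h.one_le n).trans (h.le_dim n)
  have h1 : Real.exp (-Real.log (Real.exp 1 * d n / s n)) ≤ Real.exp (-K) := by
    rw [exp_neg_log_exp_mul_div (h.one_le n) (h.le_dim n)]
    refine le_trans ?_ hn
    refine div_le_div_of_nonneg_left hs'.le hd' ?_
    exact le_mul_of_one_le_left hd'.le (Real.one_le_exp zero_le_one)
  linarith [Real.exp_le_exp.1 h1]

end SparseCov

theorem mainTheorem7 (κ : ℝ) (hκ : 0 < κ) :
    (∀ ε : ℝ, 0 < ε → ∃ lam₀ : ℝ, 0 < lam₀ ∧ ∀ lam : ℝ, 0 < lam → lam ≤ lam₀ →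
      ∀ C : ℝ, 1 < C → ∀ α : ℝ, 0 < α → α < 1 →
      ∀ 𝓜 : SparseCov.Model, 𝓜.IsAdmissible →
      ∀ m d s : ℕ → ℕ, SparseCov.Regime κ m d s →
        ∀ᶠ n : ℕ in atTop,
          ENNReal.ofReal (1 - α - ε) ≤
            SparseCov.minimaxTypeII 𝓜 α C lam n (m n) (s n) (d n)) ∧
    (∃ lam₀ : ℝ, 0 < lam₀ ∧ ∀ lam : ℝ, 0 < lam → lam ≤ lam₀ →
      ∀ C : ℝ, 1 < C → ∀ α : ℝ, 0 < α → α < 1 →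
      ∀ 𝓜 : SparseCov.Model, 𝓜.IsAdmissible →
      ∀ m d s : ℕ → ℕ, SparseCov.Regime κ m d s →
        Tendsto (fun n : ℕ => (s n : ℝ) / d n) atTop (𝓝 0) →
        ∀ ε : ℝ, 0 < ε → ∀ᶠ n : ℕ in atTop,
          ENNReal.ofReal (1 - α - ε) ≤
            SparseCov.minimaxTypeII 𝓜 α C lam n (m n) (s n) (d n)) := by
  constructor
  · intro ε hε
    -- `1 / 64` is the range of `a` in `sum_exp_overlap_sq_le`; `ε² / 224` gives `224 a / L ≤ ε²`,
    -- as `L ≥ 1`.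
    have hc : 0 < min (1 / 64) (ε ^ 2 / 224) := by positivity
    refine ⟨Real.sqrt (min (1 / 64) (ε ^ 2 / 224) / (4 * (1 + κ))), by positivity, ?_⟩
    intro lam hlam hle C hC α hα _ 𝓜 h𝓜 m d s hreg
    have h1 := SparseCov.four_mul_sq_mul_le_of_le_sqrt hκ hc.le hlam hle
    refine hreg.eventually_le_minimaxTypeII h𝓜 hα hε hC hlam (h1.trans (min_le_left _ _))
      (Eventually.of_forall fun n => ?_)
    have hL := SparseCov.one_le_log_exp_mul_div (hreg.one_le n) (hreg.le_dim n)
    refine (div_le_self (by positivity) hL).trans ?_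
    have h2 := h1.trans (min_le_right _ _)
    linarith
  · refine ⟨Real.sqrt (1 / 64 / (4 * (1 + κ))), by positivity, ?_⟩
    intro lam hlam hle C hC α hα _ 𝓜 h𝓜 m d s hreg hsd ε hε
    have h1 := SparseCov.four_mul_sq_mul_le_of_le_sqrt hκ (by norm_num) hlam hle
    refine hreg.eventually_le_minimaxTypeII h𝓜 hα hε hC hlam h1 ?_
    -- With `a ≤ 1/64` one has `224 a ≤ 3.5 < 4`, so `L ≥ 4 / ε²` suffices and `lam` need not depend
    -- on `ε`.
    filter_upwards [SparseCov.eventually_le_log_of_tendsto_div hreg hsd (4 / ε ^ 2)] with n hn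
    have hL := SparseCov.one_le_log_exp_mul_div (hreg.one_le n) (hreg.le_dim n)
    rw [div_le_iff₀ (by linarith)]
    have h2 : ε ^ 2 * (4 / ε ^ 2) ≤ ε ^ 2 * Real.log (Real.exp 1 * d n / s n) := by gcongr
    rw [mul_div_cancel₀ _ (by positivity)] at h2
    linarith
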